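/- Let $S$ be a finite set of modes and let $\mathcal M=(S,\hat s,\Sigma,T)$ be a Markov decision process with finite action set $\Sigma$, initial mode $\hat s$ and transition probabilities $T(s,\sigma,s')$; for every $(s,\sigma)$ the row $T(s,\sigma,\cdot)$ is either a probability distribution on $S$ or identically $0$ (the action $\sigma$ is not defined at $s$). Let $\pi$ be a randomized policy, i.e. for every $s$, $\pi(s,\cdot)$ is a probability distribution on the actions defined at $s$. Let $(s_k)_{k\ge 0}$ be the induced Markov chain, with $s_0=\hat s$ and transition matrix $P_{ij}=\sum_{\sigma\in\Sigma}T(i,\sigma,j)\,\pi(i,\sigma)$. For matrices $A_s\in\mathbb R^{n\times n}$, $s\in S$, consider the switched linear system $x_{k+1}=A_{s_k}x_k$. Let constants $0<\alpha_s<1$ and $\mu_s>1$ ($s\in S$) be given, and suppose that there are continuous positive definite functions $V_s:\mathbb R^n\to\mathbb R$ (that is, $V_s(0)=0$ and $V_s(x)>0$ for $x\ne 0$) such that, for all $x\in\mathbb R^n$ and all $s,s'\in S$ with $s\neq s'$, $$V_s(A_sx)-V_s(x)\le-\alpha_sV_s(x),\qquad V_s(x)\le\mu_sV_{s'}(x).$$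 Suppose that the induced Markov chain has a unique stationary distribution $p^\infty$, and let $\overrightarrow{p_s}=\sum_{s'\ne s}P_{s's}\,p^\infty_{s'}$ be the stationary probability of a jump into $s$ from a different mode in one time step. If $$\sum_{s\in S}\Bigl[\overrightarrow{p_s}\ln\mu_s+p^\infty_s\ln(1-\alpha_s)\Bigr]<0,$$ then the system is stable with probability one: for every initial state $x_0\in\mathbb R^n$, $\lim_{k\to\infty}\|x_k\|_\infty=0$ with probability one. -/

import Mathlib

open Filter Topology MeasureTheory

noncomputable section

/-- A finite Markov decision process with state (mode) set `S`, action set `Act`, initial state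
`init` and transition function `T`.  For each state `s` and action `a`, the row `T s a` is either a
probability distribution on `S`, or it is identically zero, which means that the action `a` is not
defined at the state `s`. -/
structure MarkovDecisionProcess (S Act : Type*) [Fintype S] where
  init : S
  T : S → Act → S → ℝ
  T_nonneg : ∀ s a s', 0 ≤ T s a s'
  T_row : ∀ s a, (∑ s', T s a s' = 1) ∨ (∀ s', T s a s' = 0)

/-- A randomized policy: at each state a probability distribution on the actions that are defined
there. -/
structure MarkovDecisionProcess.Policy {S Act : Type*} [Fintype S] [Fintype Act]
    (M : MarkovDecisionProcess S Act) where
  prob : S → Act → ℝ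
  prob_nonneg : ∀ s a, 0 ≤ prob s a
  prob_sum : ∀ s, ∑ a, prob s a = 1
  prob_undefined : ∀ s a, (∀ s', M.T s a s' = 0) → prob s a = 0

/-- A discrete time Markov chain on a finite set: an initial state and a stochastic matrix. -/
structure DiscreteTimeMarkovChain (S : Type*) [Fintype S] where
  init : S
  P : Matrix S S ℝ
  P_nonneg : ∀ i j, 0 ≤ P i j
  P_sum : ∀ i, ∑ j, P i j = 1

/-- The Markov chain induced by a policy, `P i j = ∑ a, T i a j * π i a`. -/
def MarkovDecisionProcess.inducedChain {S Act : Type*} [Fintype S] [Fintype Act]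
    (M : MarkovDecisionProcess S Act) (π : M.Policy) : DiscreteTimeMarkovChain S where
  init := M.init
  P := Matrix.of fun i j => ∑ a, M.T i a j * π.prob i a
  P_nonneg i j := Finset.sum_nonneg fun a _ => mul_nonneg (M.T_nonneg i a j) (π.prob_nonneg i a)
  P_sum i := by
    simp only [Matrix.of_apply]
    rw [Finset.sum_comm, ← π.prob_sum i]
    refine Finset.sum_congr rfl fun a _ => ?_
    rw [← Finset.sum_mul]
    rcases M.T_row i a with h | h
    · rw [h, one_mul]
    · rw [π.prob_undefined i a h, mul_zero]

namespace DiscreteTimeMarkovChain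

/-- `p` is a stationary distribution of the chain. -/
structure IsStationary {S : Type*} [Fintype S] (C : DiscreteTimeMarkovChain S) (p : S → ℝ) :
    Prop where
  nonneg : ∀ s, 0 ≤ p s
  sum_eq_one : ∑ s, p s = 1
  balance : ∀ s, p s = ∑ s', p s' * C.P s' s

/-- `p` is the unique stationary distribution of the chain. -/
def IsUniqueStationary {S : Type*} [Fintype S] (C : DiscreteTimeMarkovChain S) (p : S → ℝ) :
    Prop :=
  C.IsStationary p ∧ ∀ q, C.IsStationary q → q = p

/-- The stationary probability of a jump, in one time step, into the state `s` from a different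
state. -/
def jumpRate {S : Type*} [Fintype S] [DecidableEq S] (C : DiscreteTimeMarkovChain S)
    (p : S → ℝ) (s : S) : ℝ :=
  ∑ s' ∈ Finset.univ.erase s, C.P s' s * p s'

/-- The process `X` on the probability space `(Ω, ℙ)` is a realization of the chain `C`: it starts
in `C.init`, and every finite path has as its probability the product of the transition
probabilities along it. -/
structure IsRealization {S : Type*} [Fintype S] [DecidableEq S] (C : DiscreteTimeMarkovChain S)
    {Ω : Type*} [MeasurableSpace Ω] (ℙ : Measure Ω) (X : ℕ → Ω → S) : Prop where
  measurableSet_eq : ∀ k i, MeasurableSet {ω | X k ω = i}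
  path_law : ∀ (k : ℕ) (i : ℕ → S),
    ℙ {ω | ∀ t ≤ k, X t ω = i t} =
      ENNReal.ofReal
        ((if i 0 = C.init then 1 else 0) * ∏ t ∈ Finset.range k, C.P (i t) (i (t + 1)))

end DiscreteTimeMarkovChain

/-- The state of the switched linear system `x (k + 1) = A_{s k} x k` along the mode sequence `s`,
started at `x₀`. -/
def switchedState {S : Type*} {n : ℕ} (A : S → Matrix (Fin n) (Fin n) ℝ) (s : ℕ → S)
    (x₀ : Fin n → ℝ) : ℕ → (Fin n → ℝ)
  | 0 => x₀
  | k + 1 => (A (s k)).mulVec (switchedState A s x₀ k)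

/-- Stability with probability one of the switched linear system whose random mode sequence is `X`.
The norm on `Fin n → ℝ` is the maximum norm. -/
def StableWithProbabilityOne {S : Type*} {n : ℕ} (A : S → Matrix (Fin n) (Fin n) ℝ)
    {Ω : Type*} [MeasurableSpace Ω] (ℙ : Measure Ω) (X : ℕ → Ω → S) : Prop :=
  ∀ x₀ : Fin n → ℝ, ∀ᵐ ω ∂ℙ,
    Tendsto (fun k => ‖switchedState A (fun t => X t ω) x₀ k‖) atTop (𝓝 0)

/-- A Lyapunov function candidate on `ℝⁿ`: continuous and positive definite.  Radial unboundedness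
is not required. -/
structure IsLyapunovCandidate {n : ℕ} (V : (Fin n → ℝ) → ℝ) : Prop where
  continuous : Continuous V
  map_zero : V 0 = 0
  pos : ∀ x, x ≠ 0 → 0 < V x

end

/-!
Along a trajectory, `log V` grows in one step by at most
`f i j = log (1 - α i) + (log (μ j) if i ≠ j)`, where `i`, `j` are the current and the next mode.  The
hypothesis says that the stationary mean of `f` is negative, and the proof has two parts.

*The additive functional `∑ t < k, f (X t) (X (t + 1))` tends to `-∞` almost surely*
(`IsRealization.ae_tendsto_sum_atBot`).  This avoids the ergodic theorem.  Uniqueness of the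
stationary distribution makes the space of left-invariant vectors of `P` one-dimensional, because the
absolute value of an invariant vector is invariant.  By duality the Poisson equation `h - P h = g` is
solvable whenever `g` has stationary mean zero (`IsUniqueStationary.exists_poisson`).  Adding the
coboundary `h j - h i` to `f` yields a cost `w` whose conditional mean is the same negative number at
*every* mode, so for small `θ > 0` all row sums `∑ j, P i j * exp (θ * w i j)` are at most some
`ρ < 1`.  Hence the expectation of `exp (θ * ∑ w)` over the first `k` steps is at most `ρ ^ k`, which
is summable, and `exp (θ * ∑ w) → 0` almost surely.  As `h` is bounded, the same holds for `f`.

*Convergence of `V` to zero forces convergence of the state* (`tendsto_norm_switchedState`).  The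
functions `V s` may tend to zero at infinity, so small `V` alone does not bound the state.
However, the system is linear, so the initial state may be scaled down until the bound on `V` is below
the minimum of all `V s` on a shell that is too thick to be crossed in one step; the trajectory
then stays inside the shell, where small `V` does mean small norm.
-/

open Filter Topology MeasureTheory

/-! ### Invariant vectors and the Poisson equation -/

namespace DiscreteTimeMarkovChain

variable {S : Type*} [Fintype S] {C : DiscreteTimeMarkovChain S}

/-- The triangle inequality gives `|v| ≤ |v| P` entrywise, and the two sides have the same sum. -/
lemma abs_invariant (C : DiscreteTimeMarkovChain S) {v : S → ℝ}
    (hv : ∀ j, v j = ∑ i, v i * C.P i j) (j : S) : |v j| = ∑ i, |v i| * C.P i j := by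
  have hle : ∀ j ∈ Finset.univ, |v j| ≤ ∑ i, |v i| * C.P i j := fun j _ => by
    rw [hv j]
    refine (Finset.abs_sum_le_sum_abs _ _).trans_eq (Finset.sum_congr rfl fun i _ => ?_)
    rw [abs_mul, abs_of_nonneg (C.P_nonneg i j)]
  have hsum : ∑ j, |v j| = ∑ j, ∑ i, |v i| * C.P i j := by
    rw [Finset.sum_comm]
    refine Finset.sum_congr rfl fun i _ => ?_
    rw [← Finset.mul_sum, C.P_sum, mul_one]
  exact (Finset.sum_eq_sum_iff_of_le hle).1 hsum j (Finset.mem_univ j)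

lemma IsUniqueStationary.eq_sum_mul_of_nonneg {p : S → ℝ} (hp : C.IsUniqueStationary p)
    {v : S → ℝ} (hv : ∀ j, v j = ∑ i, v i * C.P i j) (h0 : ∀ j, 0 ≤ v j) (j : S) :
    v j = (∑ i, v i) * p j := by
  rcases (Finset.sum_nonneg fun i (_ : i ∈ Finset.univ) => h0 i).eq_or_lt with hs | hs
  · rw [← hs, zero_mul]
    exact (Finset.sum_eq_zero_iff_of_nonneg fun i _ => h0 i).1 hs.symm j (Finset.mem_univ j)
  · have hq : C.IsStationary fun j => (∑ i, v i)⁻¹ * v j :=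
      { nonneg := fun j => mul_nonneg (inv_nonneg.2 hs.le) (h0 j)
        sum_eq_one := by rw [← Finset.mul_sum, inv_mul_cancel₀ hs.ne']
        balance := fun j => by
          simp only [mul_assoc]
          rw [← Finset.mul_sum, ← hv j] }
    rw [← hp.2 _ hq, mul_inv_cancel_left₀ hs.ne']

/-- Every left-invariant vector is a multiple of the unique stationary distribution. -/
lemma IsUniqueStationary.eq_sum_mul {p : S → ℝ} (hp : C.IsUniqueStationary p)
    {v : S → ℝ} (hv : ∀ j, v j = ∑ i, v i * C.P i j) (j : S) :
    v j = (∑ i, v i) * p j := by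
  have habs := C.abs_invariant hv
  -- `|v|` and `|v| + v` are nonnegative invariant vectors whose difference is `v`.
  have h1 := hp.eq_sum_mul_of_nonneg habs (fun j => abs_nonneg _) j
  have h2 := hp.eq_sum_mul_of_nonneg (v := fun j => |v j| + v j)
    (fun j => by
      simp only [add_mul, Finset.sum_add_distrib]
      rw [← habs j, ← hv j])
    (fun j => by linarith [neg_abs_le (v j)]) j
  simp only [Finset.sum_add_distrib, add_mul] at h2
  linarith

/-- The Poisson equation `h - P h = g` is solvable for every `g` of stationary mean zero: a linear
functional that vanishes on the range of `1 - P` is a left-invariant vector, hence a multiple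
of `p`. -/
lemma IsUniqueStationary.exists_poisson {p : S → ℝ} (hp : C.IsUniqueStationary p)
    (g : S → ℝ) (hg : ∑ i, p i * g i = 0) :
    ∃ h : S → ℝ, ∀ i, h i - ∑ j, C.P i j * h j = g i := by
  classical
  let L : (S → ℝ) →ₗ[ℝ] (S → ℝ) := LinearMap.id - C.P.mulVecLin
  have hL : ∀ h i, L h i = h i - ∑ j, C.P i j * h j := fun h i => by
    simp [L, Matrix.mulVec, dotProduct]
  by_cases hmem : g ∈ LinearMap.range L
  · obtain ⟨h, rfl⟩ := hmem
    exact ⟨h, fun i => (hL h i).symm⟩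
  · exfalso
    obtain ⟨φ, hφg, hφ⟩ := Submodule.exists_le_ker_of_notMem hmem
    have hrep : ∀ x : S → ℝ, φ x = ∑ i, x i * φ (Pi.single i 1) := fun x => by
      conv_lhs => rw [← Finset.univ_sum_single x]
      rw [map_sum]
      refine Finset.sum_congr rfl fun i _ => ?_
      rw [← smul_eq_mul, ← map_smul, ← Pi.single_smul, smul_eq_mul, mul_one]
    have hinv : ∀ j, φ (Pi.single j 1) = ∑ i, φ (Pi.single i 1) * C.P i j := fun j => by
      have h1 : φ (L (Pi.single j 1)) = 0 := hφ ⟨_, rfl⟩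
      rw [hrep] at h1
      simp only [hL, sub_mul, Finset.sum_sub_distrib] at h1
      simp only [Pi.single_apply, mul_ite, mul_one, mul_zero, Finset.sum_ite_eq',
        Finset.mem_univ, if_true, ite_mul, one_mul, zero_mul] at h1
      rw [sub_eq_zero] at h1
      rw [h1]
      exact Finset.sum_congr rfl fun i _ => mul_comm _ _
    apply hφg
    have hmul : ∀ i, φ (Pi.single i 1) = (∑ i, φ (Pi.single i 1)) * p i :=
      hp.eq_sum_mul hinv
    rw [hrep, ← mul_zero (∑ i, φ (Pi.single i 1)), ← hg, Finset.mul_sum]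
    refine Finset.sum_congr rfl fun i _ => ?_
    conv_lhs => rw [hmul i]
    ring

/-! ### Exponential tilting -/

/-- A cost with negative conditional mean at every state has, for small `θ > 0`, a moment generating
function below one at every state, since its derivative at `θ = 0` is that mean. -/
lemma exists_sum_exp_le [Nonempty S] (C : DiscreteTimeMarkovChain S) {w : S → S → ℝ}
    (hw : ∀ i, ∑ j, C.P i j * w i j < 0) :
    ∃ θ > 0, ∃ ρ < 1, ∀ i, ∑ j, C.P i j * Real.exp (θ * w i j) ≤ ρ := by
  have key : ∀ i, ∀ᶠ θ in 𝓝[>] (0 : ℝ), ∑ j, C.P i j * Real.exp (θ * w i j) < 1 := fun i => by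
    have hd : HasDerivAt (fun θ : ℝ => ∑ j, C.P i j * Real.exp (θ * w i j))
        (∑ j, C.P i j * w i j) 0 := by
      refine HasDerivAt.fun_sum fun j _ => ?_
      have := (((hasDerivAt_id (0 : ℝ)).mul_const (w i j)).exp).const_mul (C.P i j)
      simpa using this
    have hs := (hasDerivAt_iff_tendsto_slope.1 hd).eventually (gt_mem_nhds (hw i))
    have hs' := hs.filter_mono (nhdsWithin_mono (0 : ℝ) (fun x (hx : 0 < x) => hx.ne'))
    filter_upwards [hs', self_mem_nhdsWithin] with θ h1 (h2 : 0 < θ)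
    simp only [slope_def_field, zero_mul, Real.exp_zero, mul_one, C.P_sum, sub_zero] at h1
    rw [div_lt_iff₀ h2] at h1
    linarith
  obtain ⟨θ, hθ, hθ0⟩ := ((eventually_all.2 key).and self_mem_nhdsWithin).exists
  obtain ⟨i₀, hi₀⟩ := Finite.exists_max fun i => ∑ j, C.P i j * Real.exp (θ * w i j)
  exact ⟨θ, hθ0, _, hθ i₀, hi₀⟩

namespace IsRealization

variable [DecidableEq S] {Ω : Type*} [MeasurableSpace Ω] {ℙ : Measure Ω} {X : ℕ → Ω → S}

lemma measurableSet_path (hX : C.IsRealization ℙ X) (m : ℕ) (i : ℕ → S) :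
    MeasurableSet {ω | ∀ t ≤ m, X t ω = i t} := by
  simp only [Set.ofPred_forall]
  exact MeasurableSet.iInter fun t => MeasurableSet.iInter fun _ => hX.measurableSet_eq t (i t)

lemma measurable_comp (hX : C.IsRealization ℙ X) (a : S → S → ENNReal) (t u : ℕ) :
    Measurable fun ω => a (X t ω) (X u ω) := by
  let _ : MeasurableSpace S := ⊤
  have hm : ∀ k, Measurable (X k) := fun k =>
    measurable_to_countable' fun i => hX.measurableSet_eq k i
  exact (measurable_of_countable fun q : S × S => a q.1 q.2).comp ((hm t).prodMk (hm u))

/-- The Markov property, for a path prolonged by one step. -/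
lemma measure_path_update (hX : C.IsRealization ℙ X) (m : ℕ) (i : ℕ → S) (l : S) :
    ℙ {ω | ∀ t ≤ m + 1, X t ω = Function.update i (m + 1) l t} =
      ℙ {ω | ∀ t ≤ m, X t ω = i t} * ENNReal.ofReal (C.P (i m) l) := by
  rw [hX.path_law, hX.path_law, ← ENNReal.ofReal_mul]
  · congr 1
    rw [Finset.prod_range_succ, ← mul_assoc]
    have h0 : Function.update i (m + 1) l 0 = i 0 := Function.update_of_ne (by omega) _ _
    have hm : Function.update i (m + 1) l m = i m := Function.update_of_ne (by omega) _ _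
    rw [h0, hm, Function.update_self]
    congr 2
    refine Finset.prod_congr rfl fun t ht => ?_
    have := Finset.mem_range.1 ht
    rw [Function.update_of_ne (by omega), Function.update_of_ne (by omega)]
  · exact mul_nonneg (by split_ifs <;> norm_num)
      (Finset.prod_nonneg fun t _ => C.P_nonneg _ _)

/-- A multiplicative functional whose conditional one-step mean is at most `ρ` at every state has
mean at most `ρ ^ k` over `k` steps, conditionally on any initial path. -/
lemma setLIntegral_prod_le (hX : C.IsRealization ℙ X) {a : S → S → ENNReal}
    (ha : ∀ i j, a i j ≠ ⊤) {ρ : ENNReal}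
    (hρ : ∀ i, ∑ j, ENNReal.ofReal (C.P i j) * a i j ≤ ρ) (k m : ℕ) (i : ℕ → S) :
    ∫⁻ ω in {ω | ∀ t ≤ m, X t ω = i t},
        ∏ t ∈ Finset.range k, a (X (m + t) ω) (X (m + t + 1) ω) ∂ℙ ≤
      ρ ^ k * ℙ {ω | ∀ t ≤ m, X t ω = i t} := by
  induction k generalizing m i with
  | zero => simp
  | succ k ih =>
    have hsub : {ω | ∀ t ≤ m, X t ω = i t} ⊆
        ⋃ l, {ω | ∀ t ≤ m + 1, X t ω = Function.update i (m + 1) l t} := fun ω hω => by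
      refine Set.mem_iUnion.2 ⟨X (m + 1) ω, fun t ht => ?_⟩
      rcases ht.eq_or_lt with rfl | ht
      · rw [Function.update_self]
      · rw [Function.update_of_ne ht.ne]
        exact hω t (by omega)
    refine (lintegral_mono_set hsub).trans ((lintegral_iUnion_le _ _).trans ?_)
    rw [tsum_fintype]
    have hstep : ∀ l, ∫⁻ ω in {ω | ∀ t ≤ m + 1, X t ω = Function.update i (m + 1) l t},
        ∏ t ∈ Finset.range (k + 1), a (X (m + t) ω) (X (m + t + 1) ω) ∂ℙ ≤
        ρ ^ k * ℙ {ω | ∀ t ≤ m, X t ω = i t} * (ENNReal.ofReal (C.P (i m) l) * a (i m) l) :=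
      fun l => by
        have hcongr : ∫⁻ ω in {ω | ∀ t ≤ m + 1, X t ω = Function.update i (m + 1) l t},
            ∏ t ∈ Finset.range (k + 1), a (X (m + t) ω) (X (m + t + 1) ω) ∂ℙ =
            ∫⁻ ω in {ω | ∀ t ≤ m + 1, X t ω = Function.update i (m + 1) l t},
              (∏ t ∈ Finset.range k, a (X (m + 1 + t) ω) (X (m + 1 + t + 1) ω)) *
                a (i m) l ∂ℙ := by
          refine setLIntegral_congr_fun (hX.measurableSet_path _ _) fun ω hω => ?_
          have h1 : X m ω = i m := by
            rw [hω m (by omega), Function.update_of_ne (by omega)]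
          have h2 : X (m + 1) ω = l := by rw [hω (m + 1) le_rfl, Function.update_self]
          simp only [Finset.prod_range_succ', add_zero, h1, h2]
          congr 1
          refine Finset.prod_congr rfl fun t _ => ?_
          rw [show m + (t + 1) = m + 1 + t by ring]
        rw [hcongr, lintegral_mul_const' _ _ (ha _ _)]
        refine (mul_le_mul_left (ih (m + 1) _) _).trans_eq ?_
        rw [hX.measure_path_update]
        ring
    refine (Finset.sum_le_sum fun l _ => hstep l).trans ?_
    rw [← Finset.mul_sum]
    refine (mul_le_mul_right (hρ (i m)) _).trans_eq ?_
    ring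

lemma lintegral_prod_le [IsProbabilityMeasure ℙ] (hX : C.IsRealization ℙ X)
    {a : S → S → ENNReal} (ha : ∀ i j, a i j ≠ ⊤) {ρ : ENNReal}
    (hρ : ∀ i, ∑ j, ENNReal.ofReal (C.P i j) * a i j ≤ ρ) (k : ℕ) :
    ∫⁻ ω, ∏ t ∈ Finset.range k, a (X t ω) (X (t + 1) ω) ∂ℙ ≤ ρ ^ k := by
  have hinit : ∀ᵐ ω ∂ℙ, ω ∈ {ω | ∀ t ≤ 0, X t ω = (fun _ => C.init) t} := by
    refine (mem_ae_iff_prob_eq_one (hX.measurableSet_path 0 _)).2 ?_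
    rw [hX.path_law]
    simp
  have h := hX.setLIntegral_prod_le ha hρ k 0 fun _ => C.init
  rw [Measure.restrict_eq_self_of_ae_mem hinit] at h
  refine le_trans (by simpa using h) ?_
  exact mul_le_of_le_one_right' prob_le_one

lemma ae_tendsto_prod_zero [IsProbabilityMeasure ℙ] (hX : C.IsRealization ℙ X)
    {a : S → S → ENNReal} (ha : ∀ i j, a i j ≠ ⊤) {ρ : ENNReal} (hρ1 : ρ < 1)
    (hρ : ∀ i, ∑ j, ENNReal.ofReal (C.P i j) * a i j ≤ ρ) :
    ∀ᵐ ω ∂ℙ, Tendsto (fun k => ∏ t ∈ Finset.range k, a (X t ω) (X (t + 1) ω)) atTop (𝓝 0) := by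
  have hmeas : ∀ k, Measurable fun ω => ∏ t ∈ Finset.range k, a (X t ω) (X (t + 1) ω) :=
    fun k => Finset.measurable_fun_prod _ fun t _ => hX.measurable_comp a _ _
  have hfin : ∫⁻ ω, ∑' k, ∏ t ∈ Finset.range k, a (X t ω) (X (t + 1) ω) ∂ℙ ≠ ⊤ := by
    rw [lintegral_tsum fun k => (hmeas k).aemeasurable]
    refine ne_top_of_le_ne_top ?_ (ENNReal.tsum_le_tsum fun k => hX.lintegral_prod_le ha hρ k)
    rw [ENNReal.tsum_geometric]
    exact ENNReal.inv_ne_top.2 (tsub_pos_of_lt hρ1).ne'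
  filter_upwards [ae_lt_top (Measurable.tsum hmeas) hfin] with ω hω
  exact ENNReal.tendsto_atTop_zero_of_tsum_ne_top hω.ne

/-- An additive functional of the transitions whose stationary mean is negative tends to `-∞` almost
surely. -/
theorem ae_tendsto_sum_atBot [IsProbabilityMeasure ℙ] (hX : C.IsRealization ℙ X) {p : S → ℝ}
    (hp : C.IsUniqueStationary p) {f : S → S → ℝ}
    (hf : ∑ i, p i * ∑ j, C.P i j * f i j < 0) :
    ∀ᵐ ω ∂ℙ, Tendsto (fun k => ∑ t ∈ Finset.range k, f (X t ω) (X (t + 1) ω)) atTop atBot := by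
  have : Nonempty S := ⟨C.init⟩
  set c := ∑ i, p i * ∑ j, C.P i j * f i j with hc
  obtain ⟨h, hh⟩ := hp.exists_poisson (fun i => ∑ j, C.P i j * f i j - c) (by
    simp only [mul_sub, Finset.sum_sub_distrib, ← Finset.sum_mul, hp.1.sum_eq_one, one_mul]
    rw [← hc, sub_self])
  have hw : ∀ i, ∑ j, C.P i j * (f i j + (h j - h i)) < 0 := fun i => by
    have h1 := hh i
    simp only [mul_add, mul_sub, Finset.sum_add_distrib, Finset.sum_sub_distrib,
      ← Finset.sum_mul, C.P_sum, one_mul]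
    linarith
  obtain ⟨θ, hθ, ρ, hρ, hle⟩ := C.exists_sum_exp_le hw
  have htend := hX.ae_tendsto_prod_zero
    (a := fun i j => ENNReal.ofReal (Real.exp (θ * (f i j + (h j - h i)))))
    (fun i j => ENNReal.ofReal_ne_top) (ρ := ENNReal.ofReal ρ)
    (by simpa using hρ)
    (fun i => by
      rw [Finset.sum_congr rfl fun j _ => (ENNReal.ofReal_mul (C.P_nonneg i j)).symm,
        ← ENNReal.ofReal_sum_of_nonneg fun j _ =>
          mul_nonneg (C.P_nonneg i j) (Real.exp_pos _).le]
      exact ENNReal.ofReal_le_ofReal (hle i))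
  obtain ⟨i₀, hi₀⟩ := Finite.exists_min h
  filter_upwards [htend] with ω hω
  -- The coboundary telescopes.
  have hprod : ∀ k, ∏ t ∈ Finset.range k, ENNReal.ofReal (Real.exp
      (θ * (f (X t ω) (X (t + 1) ω) + (h (X (t + 1) ω) - h (X t ω))))) =
      ENNReal.ofReal (Real.exp (θ * (∑ t ∈ Finset.range k, f (X t ω) (X (t + 1) ω) +
        (h (X k ω) - h (X 0 ω))))) := fun k => by
    rw [← ENNReal.ofReal_prod_of_nonneg fun t _ => (Real.exp_pos _).le, ← Real.exp_sum,
      ← Finset.mul_sum, Finset.sum_add_distrib, Finset.sum_range_sub fun t => h (X t ω)]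
  simp only [hprod] at hω
  have h1 := (ENNReal.tendsto_toReal ENNReal.zero_ne_top).comp hω
  simp only [Function.comp_def, ENNReal.toReal_ofReal (Real.exp_pos _).le,
    ENNReal.toReal_zero] at h1
  have h2 := Real.tendsto_exp_comp_nhds_zero.1 h1
  have h3 := (tendsto_const_mul_atBot_of_pos hθ).1 h2
  refine tendsto_atBot_mono (fun k => ?_)
    (tendsto_atBot_add_const_right _ (h (X 0 ω) - h i₀) h3)
  linarith [hi₀ (X k ω)]

end IsRealization

end DiscreteTimeMarkovChain

/-! ### Lyapunov functions along a fixed mode sequence -/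

lemma switchedState_smul {S : Type*} {n : ℕ} (A : S → Matrix (Fin n) (Fin n) ℝ) (s : ℕ → S)
    (c : ℝ) (x₀ : Fin n → ℝ) (k : ℕ) :
    switchedState A s (c • x₀) k = c • switchedState A s x₀ k := by
  induction k with
  | zero => rfl
  | succ k ih => rw [switchedState, switchedState, ih, Matrix.mulVec_smul]

/-- Finitely many Lyapunov candidates have a common positive lower bound on a shell. -/
lemma exists_pos_le_of_shell {S : Type*} [Finite S] {n : ℕ} {V : S → (Fin n → ℝ) → ℝ}
    (hV : ∀ s, IsLyapunovCandidate (V s)) {r : ℝ} (hr : 0 < r) (R : ℝ) :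
    ∃ m > 0, ∀ s x, r ≤ ‖x‖ → ‖x‖ ≤ R → m ≤ V s x := by
  have hK : IsCompact {x : Fin n → ℝ | r ≤ ‖x‖ ∧ ‖x‖ ≤ R} := by
    have : {x : Fin n → ℝ | r ≤ ‖x‖ ∧ ‖x‖ ≤ R} =
        Metric.closedBall 0 R ∩ {x | r ≤ ‖x‖} := by
      ext x
      simp [and_comm]
    rw [this]
    exact (isCompact_closedBall _ _).inter_right (isClosed_le continuous_const continuous_norm)
  have h1 : ∀ s, ∃ m > 0, ∀ x, r ≤ ‖x‖ → ‖x‖ ≤ R → m ≤ V s x := fun s => by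
    obtain ⟨m, hm, hmV⟩ := hK.exists_forall_le' (hV s).continuous.continuousOn (a := 0)
      fun x hx => (hV s).pos x (norm_pos_iff.1 (hr.trans_le hx.1))
    exact ⟨m, hm, fun x hx hx' => hmV x ⟨hx, hx'⟩⟩
  choose m hm hmV using h1
  cases isEmpty_or_nonempty S with
  | inl h => exact ⟨1, one_pos, fun s => isEmptyElim s⟩
  | inr h =>
    obtain ⟨s₀, hs₀⟩ := Finite.exists_min m
    exact ⟨m s₀, hm s₀, fun s x hx hx' => (hs₀ s).trans (hmV s x hx hx')⟩

/-- If `V (s k)` decays along the trajectory, at a rate independent of the initial state, then every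
trajectory tends to zero.  No radial unboundedness is needed, thanks to linearity. -/
theorem tendsto_norm_switchedState {S : Type*} [Finite S] {n : ℕ}
    (A : S → Matrix (Fin n) (Fin n) ℝ) {V : S → (Fin n → ℝ) → ℝ}
    (hV : ∀ s, IsLyapunovCandidate (V s)) (s : ℕ → S) {e : ℕ → ℝ}
    (he : Tendsto e atTop (𝓝 0))
    (hdec : ∀ x₀ k, V (s k) (switchedState A s x₀ k) ≤ e k * V (s 0) x₀) (x₀ : Fin n → ℝ) :
    Tendsto (fun k => ‖switchedState A s x₀ k‖) atTop (𝓝 0) := by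
  have hgain : ∃ L, 1 ≤ L ∧ ∀ i x, ‖(A i).mulVec x‖ ≤ L * ‖x‖ := by
    obtain ⟨L, hL⟩ := (Set.finite_range fun i =>
      ‖LinearMap.toContinuousLinearMap (A i).mulVecLin‖).bddAbove
    refine ⟨max 1 L, le_max_left _ _, fun i x => ?_⟩
    refine ((LinearMap.toContinuousLinearMap (A i).mulVecLin).le_opNorm x).trans ?_
    exact mul_le_mul_of_nonneg_right ((hL ⟨i, rfl⟩).trans (le_max_right _ _)) (norm_nonneg _)
  obtain ⟨L, hL1, hL⟩ := hgain
  obtain ⟨m, hm, hmV⟩ := exists_pos_le_of_shell hV one_pos L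
  obtain ⟨E, hE⟩ := he.bddAbove_range
  have hEk : ∀ k, e k ≤ E := fun k => hE ⟨k, rfl⟩
  -- Scale the initial state so that it lies in the unit ball and `V` stays below `m`.
  have hscale : ∃ c : ℝ, 0 < c ∧ ‖c • x₀‖ < 1 ∧ E * V (s 0) (c • x₀) < m := by
    have h0 : Tendsto (fun c : ℝ => c • x₀) (𝓝[>] 0) (𝓝 0) := by
      have : Continuous fun c : ℝ => c • x₀ := by fun_prop
      simpa using (this.tendsto 0).mono_left nhdsWithin_le_nhds
    have h1 : ∀ᶠ c : ℝ in 𝓝[>] 0, ‖c • x₀‖ < 1 :=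
      (by simpa using h0.norm : Tendsto (fun c : ℝ => ‖c • x₀‖) (𝓝[>] 0) (𝓝 0)).eventually
        (gt_mem_nhds one_pos)
    have h2 : Tendsto (fun c : ℝ => E * V (s 0) (c • x₀)) (𝓝[>] 0) (𝓝 0) := by
      have := (((hV (s 0)).continuous.tendsto 0).comp h0).const_mul E
      simpa [(hV (s 0)).map_zero, Function.comp_def] using this
    obtain ⟨c, ⟨hc1, hc2⟩, hc0⟩ :=
      ((h1.and (h2.eventually (gt_mem_nhds hm))).and self_mem_nhdsWithin).exists
    exact ⟨c, hc0, hc1, hc2⟩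
  obtain ⟨c, hc, hc1, hc2⟩ := hscale
  have hV0 : 0 ≤ V (s 0) (c • x₀) := by
    by_cases h : c • x₀ = 0
    · rw [h, (hV _).map_zero]
    · exact ((hV _).pos _ h).le
  have hball : ∀ k, ‖switchedState A s (c • x₀) k‖ < 1 := fun k => by
    induction k with
    | zero => exact hc1
    | succ k ih =>
      by_contra! hge
      have hle : ‖switchedState A s (c • x₀) (k + 1)‖ ≤ L :=
        (hL _ _).trans (mul_le_of_le_one_right (zero_le_one.trans hL1) ih.le)
      have h1 := hmV (s (k + 1)) _ hge hle
      have h2 := hdec (c • x₀) (k + 1)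
      have h3 := mul_le_mul_of_nonneg_right (hEk (k + 1)) hV0
      linarith
  have hscaled : Tendsto (fun k => ‖switchedState A s (c • x₀) k‖) atTop (𝓝 0) := by
    refine tendsto_order.2 ⟨fun b hb => .of_forall fun k => hb.trans_le (norm_nonneg _),
      fun ε hε => ?_⟩
    obtain ⟨m', hm', hmV'⟩ := exists_pos_le_of_shell hV hε 1
    have h1 : Tendsto (fun k => e k * V (s 0) (c • x₀)) atTop (𝓝 0) := by
      simpa using he.mul_const (V (s 0) (c • x₀))
    filter_upwards [h1.eventually (gt_mem_nhds hm')] with k hk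
    by_contra! hge
    linarith [hmV' (s k) _ hge (hball k).le, hdec (c • x₀) k]
  have := hscaled.const_mul c⁻¹
  simpa [switchedState_smul, norm_smul, abs_of_pos hc, hc.ne'] using this

/-! ### Stability of the switched system -/

/-- The bound on the increment of `log V` in a step from mode `i` to mode `j`. -/
noncomputable def logIncrement {S : Type*} [DecidableEq S] (α μ : S → ℝ) (i j : S) : ℝ :=
  Real.log (1 - α i) + if i = j then 0 else Real.log (μ j)

/-- The stationary mean of `logIncrement`. -/
lemma sum_mul_logIncrement {S : Type*} [Fintype S] [DecidableEq S]
    (C : DiscreteTimeMarkovChain S) (p α μ : S → ℝ) :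
    ∑ i, p i * ∑ j, C.P i j * logIncrement α μ i j =
      ∑ s, (C.jumpRate p s * Real.log (μ s) + p s * Real.log (1 - α s)) := by
  simp only [logIncrement, mul_add, Finset.sum_add_distrib, ← Finset.sum_mul, C.P_sum, one_mul]
  rw [add_comm]
  congr 1
  simp only [Finset.mul_sum]
  rw [Finset.sum_comm]
  refine Finset.sum_congr rfl fun j _ => ?_
  rw [DiscreteTimeMarkovChain.jumpRate, Finset.sum_mul,
    ← Finset.add_sum_erase _ _ (Finset.mem_univ j)]
  simp only [if_true, mul_zero, zero_add]
  refine Finset.sum_congr rfl fun i hi => ?_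
  rw [if_neg (Finset.ne_of_mem_erase hi)]
  ring

lemma lyapunov_le_exp_sum_logIncrement {S : Type*} [DecidableEq S] {n : ℕ}
    (A : S → Matrix (Fin n) (Fin n) ℝ) {α μ : S → ℝ} (hα : ∀ s, α s < 1) (hμ : ∀ s, 0 < μ s)
    {V : S → (Fin n → ℝ) → ℝ}
    (hdecay : ∀ s x, V s ((A s).mulVec x) - V s x ≤ -α s * V s x)
    (hjump : ∀ s s', s ≠ s' → ∀ x, V s x ≤ μ s * V s' x)
    (s : ℕ → S) (x₀ : Fin n → ℝ) (k : ℕ) :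
    V (s k) (switchedState A s x₀ k) ≤
      Real.exp (∑ t ∈ Finset.range k, logIncrement α μ (s t) (s (t + 1))) * V (s 0) x₀ := by
  induction k with
  | zero => simp [switchedState]
  | succ k ih =>
    have hα' : 0 < 1 - α (s k) := by linarith [hα (s k)]
    have hstep : V (s k) (switchedState A s x₀ (k + 1)) ≤
        (1 - α (s k)) * V (s k) (switchedState A s x₀ k) := by
      have := hdecay (s k) (switchedState A s x₀ k)
      rw [switchedState]
      linarith
    have hswitch : V (s (k + 1)) (switchedState A s x₀ (k + 1)) ≤
        Real.exp (logIncrement α μ (s k) (s (k + 1))) *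
          V (s k) (switchedState A s x₀ k) := by
      rw [logIncrement, Real.exp_add, Real.exp_log hα']
      split_ifs with h
      · rw [← h, Real.exp_zero, mul_one]
        exact hstep
      · rw [Real.exp_log (hμ _)]
        refine (hjump _ _ (Ne.symm h) _).trans ?_
        refine (mul_le_mul_of_nonneg_left hstep (hμ _).le).trans_eq ?_
        ring
    refine hswitch.trans ((mul_le_mul_of_nonneg_left ih (Real.exp_pos _).le).trans_eq ?_)
    rw [Finset.sum_range_succ, Real.exp_add]
    ring

theorem mainTheorem1 {S Act : Type*} [Fintype S] [DecidableEq S] [Fintype Act]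
    (M : MarkovDecisionProcess S Act) (π : M.Policy)
    {n : ℕ} (A : S → Matrix (Fin n) (Fin n) ℝ)
    (α μ : S → ℝ) (hα : ∀ s, 0 < α s ∧ α s < 1) (hμ : ∀ s, 1 < μ s)
    (V : S → (Fin n → ℝ) → ℝ) (hV : ∀ s, IsLyapunovCandidate (V s))
    (hdecay : ∀ s x, V s ((A s).mulVec x) - V s x ≤ -α s * V s x)
    (hjump : ∀ s s', s ≠ s' → ∀ x, V s x ≤ μ s * V s' x)
    (p : S → ℝ) (hp : (M.inducedChain π).IsUniqueStationary p)
    (hcond : ∑ s, ((M.inducedChain π).jumpRate p s * Real.log (μ s)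
      + p s * Real.log (1 - α s)) < 0)
    {Ω : Type*} [MeasurableSpace Ω] (ℙ : Measure Ω) [IsProbabilityMeasure ℙ]
    (X : ℕ → Ω → S) (hX : (M.inducedChain π).IsRealization ℙ X) :
    StableWithProbabilityOne A ℙ X := by
  have hmean := hcond
  rw [← sum_mul_logIncrement] at hmean
  intro x₀
  filter_upwards [hX.ae_tendsto_sum_atBot hp hmean] with ω hω
  exact tendsto_norm_switchedState A hV (fun t => X t ω) (Real.tendsto_exp_atBot.comp hω)
    (lyapunov_le_exp_sum_logIncrement A (fun s => (hα s).2) (fun s => one_pos.trans (hμ s))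
      hdecay hjump _) x₀
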